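/- Let $d\ge 0$ be an integer and let $\alpha$ be a measurable action of $\mathbb R^d$ on a measurable space $(\Omega,\mathcal B)$ that preserves a probability measure $m$. Suppose that $(\Omega,\alpha,m)$ is ergodic: every $B\in\mathcal B$ with $m(\alpha_x^{-1}(B)\,\triangle\,B)=0$ for all $x\in\mathbb R^d$ satisfies $m(B)\in\{0,1\}$. Suppose also that it has pure point dynamical spectrum: $L^2(\Omega,m)$ has an orthonormal basis (of any cardinality) consisting of eigenfunctions, that is, of functions $f\neq 0$ for which there is a continuous character $\chi:\mathbb R^d\to\{z\in\mathbb C:|z|=1\}$ with $f\circ\alpha_x=\chi(x)f$ in $L^2(\Omega,m)$ for all $x\in\mathbb R^d$. Then there are a compact Hausdorff abelian group $\mathbb T$, with Borel $\sigma$-algebra and normalised Haar measure $\mu$, and a continuous action $\beta$ of $\mathbb R^d$ on $\mathbb T$ such that: 1. $\beta$ is a rotation: there is a group homomorphism $i:\mathbb R^d\to\mathbb T$ with $\beta_x(\xi)=i(x)\,\xi$ for all $x\in\mathbb R^d$, $\xi\in\mathbb T$; in particular $\mu$ is $\beta$-invariant. 2. $(\mathbb T,\beta)$ is uniquely ergodic: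 there is exactly one $\beta$-invariant Borel probability measure on $\mathbb T$ (which is therefore $\mu$). 3. $(\Omega,\alpha,m)$ and $(\mathbb T,\beta,\mu)$ are metrically isomorphic: there is a bijection $\Phi$ from the measure algebra of $(\mathbb T,\mu)$ (Borel sets modulo sets of measure $0$) onto the measure algebra of $(\Omega,m)$ that preserves complements, countable unions and measure, and satisfies $\Phi(\beta_x(V))=\alpha_x(\Phi(V))$ for all $V$ and all $x\in\mathbb R^d$. 4. If $L^2(\Omega,m)$ admits a countable orthonormal basis, then the topology of $\mathbb T$ is generated by a metric $\rho$ with $\rho(\beta_x\xi,\beta_x\eta)=\rho(\xi,\eta)$ for all $x\in\mathbb R^d$ and $\xi,\eta\in\mathbb T$. -/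

import Mathlib

open MeasureTheory
open scoped symmDiff ENNReal

/-- Two measurable sets are identified when their symmetric difference has measure `0`. -/
def measureAlgebraSetoid {X : Type*} [MeasurableSpace X] (μ : Measure X) :
    Setoid {s : Set X // MeasurableSet s} where
  r s t := μ ((s : Set X) ∆ (t : Set X)) = 0
  iseqv :=
    { refl := fun s => by simp
      symm := fun {s t} h => by rwa [symmDiff_comm]
      trans := fun {s t u} h₁ h₂ =>
        measure_mono_null (symmDiff_triangle (s : Set X) (t : Set X) (u : Set X))
          (measure_union_null h₁ h₂) }

/-- The measure algebra of `(X, μ)`: measurable sets modulo sets of measure `0`. -/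
def MeasureAlgebra {X : Type*} [MeasurableSpace X] (μ : Measure X) : Type _ :=
  Quotient (measureAlgebraSetoid μ)

namespace MeasureAlgebra

variable {X : Type*} [MeasurableSpace X] {μ : Measure X}

/-- The class of a measurable set in the measure algebra. -/
def mk (μ : Measure X) (s : {s : Set X // MeasurableSet s}) : MeasureAlgebra μ :=
  Quotient.mk (measureAlgebraSetoid μ) s

/-- The measure induced on the measure algebra. -/
noncomputable def measure (a : MeasureAlgebra μ) : ℝ≥0∞ :=
  Quotient.lift (s := measureAlgebraSetoid μ) (fun s => μ (s : Set X))
    (fun _ _ h => measure_congr (measure_symmDiff_eq_zero_iff.1 h)) a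

/-- The action of `g` on the measure algebra, sending the class of `V` to the class of the
image `g +ᵥ V` of `V` under the point map `g +ᵥ ·`. -/
def translate {G : Type*} [AddGroup G] [AddAction G X] [MeasurableConstVAdd G X]
    [VAddInvariantMeasure G X μ] (g : G) (a : MeasureAlgebra μ) : MeasureAlgebra μ :=
  Quotient.map' (s₁ := measureAlgebraSetoid μ) (s₂ := measureAlgebraSetoid μ)
    (fun s => ⟨(fun ω => g +ᵥ ω) '' (s : Set X), MeasurableSet.const_vadd s.2 g⟩)
    (fun s t h => by
      change μ (((fun ω => g +ᵥ ω) '' (s : Set X)) ∆ ((fun ω => g +ᵥ ω) '' (t : Set X))) = 0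
      rw [← Set.image_symmDiff (AddAction.injective g)]
      exact (measure_vadd μ g _).trans h) a

end MeasureAlgebra

/-- An isomorphism of measure algebras: a bijection which preserves complements, countable
unions (hence countable intersections) and the measure. -/
structure MeasureAlgebraIso {X Y : Type*} [MeasurableSpace X] [MeasurableSpace Y]
    (μ : Measure X) (ν : Measure Y) where
  toEquiv : MeasureAlgebra μ ≃ MeasureAlgebra ν
  map_compl : ∀ (s : {s : Set X // MeasurableSet s}) (t : {t : Set Y // MeasurableSet t}),
    toEquiv (MeasureAlgebra.mk μ s) = MeasureAlgebra.mk ν t →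
      toEquiv (MeasureAlgebra.mk μ ⟨(s : Set X)ᶜ, s.2.compl⟩) =
        MeasureAlgebra.mk ν ⟨(t : Set Y)ᶜ, t.2.compl⟩
  map_iUnion : ∀ (s : ℕ → {s : Set X // MeasurableSet s})
      (t : ℕ → {t : Set Y // MeasurableSet t}),
    (∀ n, toEquiv (MeasureAlgebra.mk μ (s n)) = MeasureAlgebra.mk ν (t n)) →
      toEquiv (MeasureAlgebra.mk μ
          ⟨⋃ n, (s n : Set X), MeasurableSet.iUnion fun n => (s n).2⟩) =
        MeasureAlgebra.mk ν ⟨⋃ n, (t n : Set Y), MeasurableSet.iUnion fun n => (t n).2⟩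
  map_measure : ∀ a : MeasureAlgebra μ, (toEquiv a).measure = a.measure

/-- The measure preserving `G`-actions on `(X, μ)` and `(Y, ν)` are metrically isomorphic
(conjugate modulo `0`): there is an isomorphism from the measure algebra of `(Y, ν)` to that of
`(X, μ)` that intertwines the two actions. -/
def MetricallyIsomorphic (G : Type*) [AddGroup G]
    {X : Type*} [MeasurableSpace X] [AddAction G X] [MeasurableConstVAdd G X]
    (μ : Measure X) [VAddInvariantMeasure G X μ]
    {Y : Type*} [MeasurableSpace Y] [AddAction G Y] [MeasurableConstVAdd G Y]
    (ν : Measure Y) [VAddInvariantMeasure G Y ν] : Prop :=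
  ∃ Φ : MeasureAlgebraIso ν μ, ∀ (g : G) (a : MeasureAlgebra ν),
    Φ.toEquiv (a.translate g) = (Φ.toEquiv a).translate g

/-- The unitary operator `T_g f = f ∘ (g +ᵥ ·)` on `L²(X, μ)`. -/
noncomputable def koopman {G : Type*} [AddGroup G]
    {X : Type*} [MeasurableSpace X] [AddAction G X] [MeasurableConstVAdd G X]
    (μ : Measure X) [VAddInvariantMeasure G X μ] (g : G) : Lp ℂ 2 μ →ₗᵢ[ℂ] Lp ℂ 2 μ :=
  Lp.compMeasurePreservingₗᵢ ℂ (fun ω : X => g +ᵥ ω) (measurePreserving_vadd g μ)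

/-- `f ∈ L²(X, μ)` is an eigenfunction: `f ≠ 0`, and for some continuous unitary character `χ`
of `G` one has `T_g f = χ(g) f` for all `g`. -/
def IsEigenfunction (G : Type*) [AddGroup G] [TopologicalSpace G]
    {X : Type*} [MeasurableSpace X] [AddAction G X] [MeasurableConstVAdd G X]
    (μ : Measure X) [VAddInvariantMeasure G X μ] (f : Lp ℂ 2 μ) : Prop :=
  f ≠ 0 ∧ ∃ χ : PontryaginDual (Multiplicative G), ∀ g : G,
    koopman μ g f = (χ (Multiplicative.ofAdd g) : ℂ) • f

/-- Pure point dynamical spectrum: `L²(X, μ)` has an orthonormal basis (a Hilbert basis, of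
arbitrary cardinality) consisting of eigenfunctions. -/
def HasPurePointSpectrum (G : Type*) [AddGroup G] [TopologicalSpace G]
    {X : Type*} [MeasurableSpace X] [AddAction G X] [MeasurableConstVAdd G X]
    (μ : Measure X) [VAddInvariantMeasure G X μ] : Prop :=
  ∃ (S : Set (Lp ℂ 2 μ)) (b : HilbertBasis S ℂ (Lp ℂ 2 μ)),
    (⇑b = fun f : S => (f : Lp ℂ 2 μ)) ∧ ∀ f ∈ S, IsEigenfunction G μ f

/-- `L²(X, μ)` admits a (finite or infinite) countable orthonormal basis. -/
def HasCountableOrthonormalBasis {X : Type*} [MeasurableSpace X] (μ : Measure X) : Prop :=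
  ∃ (S : Set (Lp ℂ 2 μ)) (b : HilbertBasis S ℂ (Lp ℂ 2 μ)),
    (⇑b = fun f : S => (f : Lp ℂ 2 μ)) ∧ S.Countable

/-- An action of `G` on a group `K` is a rotation if it is given by translation through a group
homomorphism `i : G → K`. -/
def IsRotation (G : Type*) [AddGroup G] (K : Type*) [Group K] [AddAction G K] : Prop :=
  ∃ i : Multiplicative G →* K, ∀ (g : G) (ξ : K), g +ᵥ ξ = i (Multiplicative.ofAdd g) * ξ

/-- There is exactly one invariant probability measure. In use, the `σ`-algebra of `X` is the
Borel `σ`-algebra of a compact space and the action is continuous. -/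
def UniquelyErgodic (G : Type*) [AddGroup G]
    (X : Type*) [MeasurableSpace X] [AddAction G X] : Prop :=
  ∃! μ : Measure X, IsProbabilityMeasure μ ∧ VAddInvariantMeasure G X μ

/-- The topology of `X` is generated by a metric that is invariant under the action of `G`. -/
def MetrisableByInvariantMetric (G : Type*) [AddGroup G]
    (X : Type*) [τ : TopologicalSpace X] [AddAction G X] : Prop :=
  ∃ d : MetricSpace X, d.toUniformSpace.toTopologicalSpace = τ ∧
    ∀ (g : G) (ξ η : X), d.dist (g +ᵥ ξ) (g +ᵥ η) = d.dist ξ η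

/-- Haar measure on a compact group, normalised to total mass `1`. -/
noncomputable def normalisedHaar (K : Type*) [Group K] [TopologicalSpace K] [IsTopologicalGroup K]
    [CompactSpace K] [MeasurableSpace K] [BorelSpace K] : Measure K :=
  Measure.haarMeasure (⊤ : TopologicalSpace.PositiveCompacts K)

/-! Ergodicity makes the modulus of an eigenfunction constant, so eigenfunctions may be taken with
values in the circle; two of them with the same character differ by a constant. The constants form a
copy of the circle, which is divisible and hence splits off as a direct factor of the group of
unimodular eigenfunctions. One can therefore choose an eigenfunction for each eigenvalue
multiplicatively (`exists_section_eigenfunctionGroup`). With pure point spectrum, this group of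
functions, indexed by the group `Γ` of eigenvalues, is an orthonormal basis of `L²`.

The compact group is the closure of the image of `G` in the torus `Γ → Circle`. Its coordinates are
again a group of unimodular eigenfunctions with the same characters, and form a basis by
Stone–Weierstrass (`span_monomial_closure_eq_top`). Matching the two bases gives a unitary operator
that commutes with the actions. Since both bases multiply in the same way, it is also multiplicative
(`IsUnimodularBasis.unitary_mul`), so it sends idempotents, that is indicator functions, to
idempotents and induces an isomorphism of measure algebras.

An invariant probability measure integrates every nontrivial coordinate to `0`, which forces unique
ergodicity. If `L²` is separable then `Γ` is countable, and a weighted product metric is invariant.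
-/

/-! ### Indicator functions in `L²` and the measure algebra -/

section Indicators

variable {X Y : Type*} [MeasurableSpace X] [MeasurableSpace Y]

/-- The indicator function of a measurable set, as an element of `Lᵖ`. -/
noncomputable def indicatorLp (p : ℝ≥0∞) (μ : Measure X) [IsFiniteMeasure μ]
    (s : {s : Set X // MeasurableSet s}) : Lp ℂ p μ :=
  indicatorConstLp p s.2 (measure_ne_top μ s) (1 : ℂ)

variable {μ : Measure X} [IsFiniteMeasure μ] {ν : Measure Y} [IsFiniteMeasure ν]

theorem coeFn_indicatorLp (p : ℝ≥0∞) (s : {s : Set X // MeasurableSet s}) :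
    indicatorLp p μ s =ᵐ[μ] (s : Set X).indicator fun _ => (1 : ℂ) :=
  indicatorConstLp_coeFn

theorem inner_indicatorLp (s t : {s : Set X // MeasurableSet s}) :
    inner ℂ (indicatorLp 2 μ s) (indicatorLp 2 μ t) = (μ.real ((s : Set X) ∩ t) : ℂ) := by
  rw [indicatorLp, L2.inner_indicatorConstLp_one,
    setIntegral_congr_ae (g := (t : Set X).indicator fun _ => (1 : ℂ)) s.2
      ((coeFn_indicatorLp 2 t).mono fun x hx _ => hx),
    setIntegral_indicator t.2]
  simp

theorem indicatorLp_eq_iff {s t : {s : Set X // MeasurableSet s}} :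
    indicatorLp 2 μ s = indicatorLp 2 μ t ↔ MeasureAlgebra.mk μ s = MeasureAlgebra.mk μ t := by
  have key : MeasureAlgebra.mk μ s = MeasureAlgebra.mk μ t ↔ (s : Set X) =ᵐ[μ] (t : Set X) :=
    Quotient.eq.trans measure_symmDiff_eq_zero_iff
  rw [key]
  constructor
  · intro h
    have h' := (coeFn_indicatorLp 2 s).symm.trans (h ▸ coeFn_indicatorLp 2 t)
    filter_upwards [h'] with x hx
    refine propext (show x ∈ (s : Set X) ↔ x ∈ (t : Set X) from ?_)
    by_cases hs : x ∈ (s : Set X) <;> by_cases ht : x ∈ (t : Set X) <;> simp_all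
  · intro h
    refine Lp.ext ((coeFn_indicatorLp 2 s).trans (.trans ?_ (coeFn_indicatorLp 2 t).symm))
    filter_upwards [h] with x hx
    have : x ∈ (s : Set X) ↔ x ∈ (t : Set X) := iff_of_eq hx
    by_cases hs : x ∈ (s : Set X) <;> simp [hs, ← this]

theorem indicatorLp_compl (s : {s : Set X // MeasurableSet s}) :
    indicatorLp 2 μ ⟨(s : Set X)ᶜ, s.2.compl⟩ =
      indicatorLp 2 μ ⟨Set.univ, MeasurableSet.univ⟩ - indicatorLp 2 μ s := by
  refine Lp.ext ?_
  filter_upwards [coeFn_indicatorLp 2 (μ := μ) ⟨(s : Set X)ᶜ, s.2.compl⟩,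
    coeFn_indicatorLp 2 s, coeFn_indicatorLp 2 (μ := μ) ⟨Set.univ, MeasurableSet.univ⟩,
    Lp.coeFn_sub (indicatorLp 2 μ ⟨Set.univ, MeasurableSet.univ⟩) (indicatorLp 2 μ s)]
    with x h1 h2 h3 h4
  rw [h4, Pi.sub_apply, h1, h2, h3]
  by_cases hx : x ∈ (s : Set X) <;> simp [hx]

/-- This expresses the order of the measure algebra through inner products of indicators, which a
unitary operator preserves. -/
theorem measure_inter_eq_iff_ae_le {s t : Set X} (ht : MeasurableSet t) :
    μ.real (s ∩ t) = μ.real s ↔ s ≤ᵐ[μ] t := by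
  rw [ae_le_set]
  have h := measureReal_inter_add_sdiff (μ := μ) (s := s) ht
  have h2 : μ.real (s \ t) = 0 ↔ μ (s \ t) = 0 := measureReal_eq_zero_iff
  rw [← h2]
  constructor <;> intro h3 <;> linarith

theorem exists_indicatorLp_eq_of_mul_self {w : Lp ℂ 2 μ} (hw : ∀ᵐ x ∂μ, w x * w x = w x) :
    ∃ t, w = indicatorLp 2 μ t := by
  refine ⟨⟨w ⁻¹' {1}, (Lp.stronglyMeasurable w).measurable (measurableSet_singleton 1)⟩,
    Lp.ext ?_⟩
  filter_upwards [hw, coeFn_indicatorLp 2 (μ := μ)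
    ⟨w ⁻¹' {1}, (Lp.stronglyMeasurable w).measurable (measurableSet_singleton 1)⟩] with x hx h2
  rw [h2]
  have h3 : w x * (w x - 1) = 0 := by rw [mul_sub, hx]; ring
  rcases mul_eq_zero.1 h3 with h | h
  · simp [Set.indicator, h]
  · simp [Set.indicator, sub_eq_zero.1 h]

/-- A unitary operator which, like its inverse, sends indicator functions to indicator functions
comes from an isomorphism of measure algebras. -/
theorem exists_measureAlgebraIso (U : Lp ℂ 2 μ ≃ₗᵢ[ℂ] Lp ℂ 2 ν)
    (hone : U (indicatorLp 2 μ ⟨Set.univ, MeasurableSet.univ⟩) =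
      indicatorLp 2 ν ⟨Set.univ, MeasurableSet.univ⟩)
    (hU : ∀ s, ∃ t, U (indicatorLp 2 μ s) = indicatorLp 2 ν t)
    (hU' : ∀ t, ∃ s, U.symm (indicatorLp 2 ν t) = indicatorLp 2 μ s) :
    ∃ Φ : MeasureAlgebraIso μ ν, ∀ s t, U (indicatorLp 2 μ s) = indicatorLp 2 ν t ↔
      Φ.toEquiv (MeasureAlgebra.mk μ s) = MeasureAlgebra.mk ν t := by
  choose σ hσ using hU
  choose τ hτ using hU'
  have hrel : ∀ s s' : {s : Set X // MeasurableSet s},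
      (measureAlgebraSetoid μ) s s' → (measureAlgebraSetoid ν) (σ s) (σ s') := by
    intro s s' h
    have h1 : MeasureAlgebra.mk μ s = MeasureAlgebra.mk μ s' := Quotient.sound h
    rw [← indicatorLp_eq_iff] at h1
    exact Quotient.exact (indicatorLp_eq_iff.1 (by rw [← hσ, ← hσ, h1]))
  have hrel' : ∀ s s' : {s : Set Y // MeasurableSet s},
      (measureAlgebraSetoid ν) s s' → (measureAlgebraSetoid μ) (τ s) (τ s') := by
    intro s s' h
    have h1 : MeasureAlgebra.mk ν s = MeasureAlgebra.mk ν s' := Quotient.sound h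
    rw [← indicatorLp_eq_iff] at h1
    exact Quotient.exact (indicatorLp_eq_iff.1 (by rw [← hτ, ← hτ, h1]))
  let e : MeasureAlgebra μ ≃ MeasureAlgebra ν :=
    { toFun := Quotient.map' (s₁ := measureAlgebraSetoid μ) (s₂ := measureAlgebraSetoid ν) σ hrel
      invFun := Quotient.map' (s₁ := measureAlgebraSetoid ν) (s₂ := measureAlgebraSetoid μ) τ hrel'
      left_inv := by
        intro a
        induction a using Quotient.inductionOn with | _ s
        change MeasureAlgebra.mk μ (τ (σ s)) = MeasureAlgebra.mk μ s
        rw [← indicatorLp_eq_iff, ← hτ, ← hσ, U.symm_apply_apply]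
      right_inv := by
        intro a
        induction a using Quotient.inductionOn with | _ s
        change MeasureAlgebra.mk ν (σ (τ s)) = MeasureAlgebra.mk ν s
        rw [← indicatorLp_eq_iff, ← hσ, ← hτ, U.apply_symm_apply] }
  have he : ∀ s t, U (indicatorLp 2 μ s) = indicatorLp 2 ν t ↔
      e (MeasureAlgebra.mk μ s) = MeasureAlgebra.mk ν t := fun s t => by
    change _ ↔ MeasureAlgebra.mk ν (σ s) = MeasureAlgebra.mk ν t
    rw [← indicatorLp_eq_iff, ← hσ]
  have hinter : ∀ s s' t t', e (MeasureAlgebra.mk μ s) = MeasureAlgebra.mk ν t →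
      e (MeasureAlgebra.mk μ s') = MeasureAlgebra.mk ν t' →
      μ.real ((s : Set X) ∩ s') = ν.real ((t : Set Y) ∩ t') := fun s s' t t' h h' => by
    rw [← he] at h h'
    have := U.inner_map_map (indicatorLp 2 μ s) (indicatorLp 2 μ s')
    rw [h, h', inner_indicatorLp, inner_indicatorLp] at this
    exact_mod_cast this.symm
  have hle : ∀ s s' t t', e (MeasureAlgebra.mk μ s) = MeasureAlgebra.mk ν t →
      e (MeasureAlgebra.mk μ s') = MeasureAlgebra.mk ν t' →
      ((s : Set X) ≤ᵐ[μ] (s' : Set X) ↔ (t : Set Y) ≤ᵐ[ν] (t' : Set Y)) :=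
    fun s s' t t' h h' => by
      have h1 := hinter s s t t h h
      rw [Set.inter_self, Set.inter_self] at h1
      rw [← measure_inter_eq_iff_ae_le s'.2, ← measure_inter_eq_iff_ae_le t'.2,
        hinter s s' t t' h h', h1]
  refine ⟨⟨e, ?_, ?_, ?_⟩, he⟩
  · intro s t h
    rw [← he] at h ⊢
    rw [indicatorLp_compl, indicatorLp_compl, map_sub, hone, h]
  · intro s t h
    -- A countable union is a least upper bound, so preservation of the order in both directions
    -- suffices. The set `τ T` pulls the upper bound `T` back to `X`.
    set S : {s : Set X // MeasurableSet s} := ⟨⋃ n, (s n : Set X), .iUnion fun n => (s n).2⟩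
    set T : {s : Set Y // MeasurableSet s} := ⟨⋃ n, (t n : Set Y), .iUnion fun n => (t n).2⟩
    have hS : e (MeasureAlgebra.mk μ S) = MeasureAlgebra.mk ν (σ S) := rfl
    have hT : e (MeasureAlgebra.mk μ (τ T)) = MeasureAlgebra.mk ν T := by
      rw [← he, ← hτ, U.apply_symm_apply]
    rw [hS]
    refine Quotient.sound (measure_symmDiff_eq_zero_iff.2 (Filter.EventuallyLE.antisymm ?_ ?_))
    · refine (hle S (τ T) _ _ hS hT).1 ?_
      have : ∀ n, (s n : Set X) ≤ᵐ[μ] (τ T : Set X) := fun n =>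
        (hle _ _ _ _ (h n) hT).2 (LE.le.eventuallyLE
          (Set.subset_iUnion (fun n => (t n : Set Y)) n))
      have h' := ae_all_iff.2 this
      filter_upwards [h'] with x hx hxS
      obtain ⟨n, hn⟩ := Set.mem_iUnion.1 (show x ∈ ⋃ n, (s n : Set X) from hxS)
      exact hx n hn
    · have : ∀ n, (t n : Set Y) ≤ᵐ[ν] (σ S : Set Y) := fun n =>
        (hle _ _ _ _ (h n) hS).1 (LE.le.eventuallyLE
          (Set.subset_iUnion (fun n => (s n : Set X)) n))
      have h' := ae_all_iff.2 this
      filter_upwards [h'] with x hx hxT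
      obtain ⟨n, hn⟩ := Set.mem_iUnion.1 (show x ∈ ⋃ n, (t n : Set Y) from hxT)
      exact hx n hn
  · intro a
    induction a using Quotient.inductionOn with | _ s
    have h1 := hinter s s (σ s) (σ s) rfl rfl
    rw [Set.inter_self, Set.inter_self] at h1
    change ν (σ s : Set Y) = μ (s : Set X)
    exact ((measureReal_eq_measureReal_iff).1 h1).symm

/-- The sign appears because the image under `g` is the preimage under `-g`. -/
theorem koopman_indicatorLp {G : Type*} [AddGroup G] [AddAction G X] [MeasurableConstVAdd G X]
    [VAddInvariantMeasure G X μ] (g : G) (s : {s : Set X // MeasurableSet s}) :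
    koopman μ (-g) (indicatorLp 2 μ s) =
      indicatorLp 2 μ ⟨(fun x => g +ᵥ x) '' (s : Set X), MeasurableSet.const_vadd s.2 g⟩ := by
  refine Lp.ext ((Lp.coeFn_compMeasurePreserving _ (measurePreserving_vadd (-g) μ)).trans
    (.trans ?_ (coeFn_indicatorLp 2 _).symm))
  refine ((measurePreserving_vadd (-g) μ).quasiMeasurePreserving.ae_eq_comp
    (coeFn_indicatorLp 2 s)).trans (.of_forall fun x => ?_)
  have : x ∈ (fun x => g +ᵥ x) '' (s : Set X) ↔ -g +ᵥ x ∈ (s : Set X) :=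
    Set.mem_vadd_set_iff_neg_vadd_mem
  by_cases hx : -g +ᵥ x ∈ (s : Set X)
  · simp [Set.indicator_of_mem (this.2 hx), hx]
  · simp [Set.indicator_of_notMem (mt this.1 hx), hx]

theorem MeasureAlgebraIso.map_translate {G : Type*} [AddGroup G]
    [AddAction G X] [MeasurableConstVAdd G X] [VAddInvariantMeasure G X μ]
    [AddAction G Y] [MeasurableConstVAdd G Y] [VAddInvariantMeasure G Y ν]
    (Φ : MeasureAlgebraIso μ ν) (U : Lp ℂ 2 μ ≃ₗᵢ[ℂ] Lp ℂ 2 ν)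
    (hΦ : ∀ s t, U (indicatorLp 2 μ s) = indicatorLp 2 ν t ↔
      Φ.toEquiv (MeasureAlgebra.mk μ s) = MeasureAlgebra.mk ν t)
    (hU : ∀ (g : G) f, U (koopman μ g f) = koopman ν g (U f)) (g : G) (a : MeasureAlgebra μ) :
    Φ.toEquiv (a.translate g) = (Φ.toEquiv a).translate g := by
  induction a using Quotient.inductionOn with | _ s
  obtain ⟨t, ht⟩ := Quotient.exists_rep (Φ.toEquiv (MeasureAlgebra.mk μ s))
  have h1 : U (indicatorLp 2 μ s) = indicatorLp 2 ν t := (hΦ s t).2 ht.symm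
  change Φ.toEquiv ((MeasureAlgebra.mk μ s).translate g) =
    (Φ.toEquiv (MeasureAlgebra.mk μ s)).translate g
  rw [← ht]
  refine (hΦ _ _).1 ?_
  rw [← koopman_indicatorLp, ← koopman_indicatorLp, hU, h1]

end Indicators

/-! ### Bases of unimodular functions and the unitary matching them -/

section Unimodular

theorem continuous_circle_coe : Continuous ((↑) : Circle → ℂ) := by fun_prop

variable {X Y : Type*} [MeasurableSpace X] [MeasurableSpace Y]

/-- A measurable function with values in the unit circle, as an element of `Lᵖ`. -/
noncomputable def unimodularLp (p : ℝ≥0∞) {μ : Measure X} [IsFiniteMeasure μ]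
    (u : X →ₘ[μ] Circle) : Lp ℂ p μ :=
  ⟨u.comp _ continuous_circle_coe, Lp.mem_Lp_iff_memLp.2 <|
    MemLp.of_bound (AEEqFun.aestronglyMeasurable _) 1 <|
      (AEEqFun.coeFn_comp _ continuous_circle_coe u).mono fun x hx => by
        rw [hx]; exact (Circle.norm_coe _).le⟩

variable {μ : Measure X} {ν : Measure Y}

theorem coeFn_unimodularLp [IsFiniteMeasure μ] (p : ℝ≥0∞) (u : X →ₘ[μ] Circle) :
    unimodularLp p u =ᵐ[μ] fun x => (u x : ℂ) :=
  AEEqFun.coeFn_comp _ continuous_circle_coe u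

theorem norm_unimodularLp_two [IsProbabilityMeasure μ] (u : X →ₘ[μ] Circle) :
    ‖unimodularLp 2 u‖ = 1 := by
  have h : eLpNorm (unimodularLp 2 u) 2 μ = eLpNorm (fun _ : X => (1 : ℂ)) 2 μ :=
    eLpNorm_congr_norm_ae ((coeFn_unimodularLp 2 u).mono fun x hx => by
      rw [hx, Circle.norm_coe, norm_one])
  rw [Lp.norm_def, h, eLpNorm_const _ two_ne_zero (IsProbabilityMeasure.ne_zero μ)]
  simp

theorem coeFn_mul_unimodularLp [IsFiniteMeasure μ] (p q r : ℝ≥0∞) (u v : X →ₘ[μ] Circle) :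
    ∀ᵐ x ∂μ, unimodularLp p (u * v) x = unimodularLp q u x * unimodularLp r v x := by
  filter_upwards [coeFn_unimodularLp p (u * v), coeFn_unimodularLp q u, coeFn_unimodularLp r v,
    AEEqFun.coeFn_mul u v] with x h1 h2 h3 h4
  rw [h1, h2, h3, h4, Pi.mul_apply, Circle.coe_mul]

theorem unimodularLp_one [IsFiniteMeasure μ] :
    unimodularLp 2 (1 : X →ₘ[μ] Circle) = indicatorLp 2 μ ⟨Set.univ, MeasurableSet.univ⟩ := by
  refine Lp.ext ?_
  filter_upwards [coeFn_unimodularLp 2 (1 : X →ₘ[μ] Circle), AEEqFun.coeFn_one (μ := μ)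
    (β := Circle), coeFn_indicatorLp 2 (μ := μ) ⟨Set.univ, MeasurableSet.univ⟩] with x h1 h2 h3
  rw [h1, h2, h3]
  simp

/-- Eigenvectors of a unitary operator for distinct eigenvalues are orthogonal; two distinct
characters differ at some `g`. -/
theorem orthonormal_unimodularLp_of_koopman [IsProbabilityMeasure μ] {G : Type*} [AddGroup G]
    [AddAction G X] [MeasurableConstVAdd G X] [VAddInvariantMeasure G X μ]
    {Γ : Type*} (F : Γ → (X →ₘ[μ] Circle)) (χ : Γ → G → Circle) (hχ : Function.Injective χ)
    (hF : ∀ γ g, koopman μ g (unimodularLp 2 (F γ)) = (χ γ g : ℂ) • unimodularLp 2 (F γ)) :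
    Orthonormal ℂ fun γ => unimodularLp 2 (F γ) := by
  refine ⟨fun γ => norm_unimodularLp_two _, fun γ δ hne => ?_⟩
  obtain ⟨g, hg⟩ := Function.ne_iff.1 (hχ.ne hne)
  have h := (koopman μ g).inner_map_map (unimodularLp 2 (F γ)) (unimodularLp 2 (F δ))
  rw [hF, hF, inner_smul_left, inner_smul_right, ← Circle.coe_inv_eq_conj, ← mul_assoc,
    ← Circle.coe_mul] at h
  by_contra h0
  have h1 : (((χ γ g)⁻¹ * χ δ g : Circle) : ℂ) = 1 := mul_right_cancel₀ h0 (by rw [h, one_mul])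
  rw [Circle.coe_eq_one, inv_mul_eq_one] at h1
  exact hg h1

/-- Multiplication `Lᵖ × L^q → L^r` of Hölder triples of exponents. -/
noncomputable def lpMul (μ : Measure X) (p q r : ℝ≥0∞) [ENNReal.HolderTriple p q r]
    [Fact (1 ≤ p)] [Fact (1 ≤ q)] [Fact (1 ≤ r)] : Lp ℂ p μ →L[ℂ] Lp ℂ q μ →L[ℂ] Lp ℂ r μ :=
  (ContinuousLinearMap.mul ℂ ℂ).holderL μ p q r

theorem coeFn_lpMul {p q r : ℝ≥0∞} [ENNReal.HolderTriple p q r]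
    [Fact (1 ≤ p)] [Fact (1 ≤ q)] [Fact (1 ≤ r)] (f : Lp ℂ p μ) (g : Lp ℂ q μ) :
    lpMul μ p q r f g =ᵐ[μ] fun x => f x * g x := by
  simpa [lpMul] using (ContinuousLinearMap.mul ℂ ℂ).coeFn_holder (r := r) f g

/-- A group of measurable functions with values in the unit circle which is an orthonormal
basis of `L²`. -/
structure IsUnimodularBasis {Γ : Type*} [Group Γ] {μ : Measure X} [IsFiniteMeasure μ]
    (F : Γ →* (X →ₘ[μ] Circle)) : Prop where
  orthonormal : Orthonormal ℂ fun γ => unimodularLp 2 (F γ)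
  span_eq_top : ⊤ ≤ (Submodule.span ℂ
    (Set.range fun γ => unimodularLp 2 (F γ))).topologicalClosure

variable [IsFiniteMeasure μ] [IsFiniteMeasure ν] {Γ : Type*} [Group Γ]
  {F : Γ →* (X →ₘ[μ] Circle)} {F' : Γ →* (Y →ₘ[ν] Circle)}

/-- The unitary operator matching two bases of unimodular functions. -/
noncomputable def IsUnimodularBasis.unitary (hF : IsUnimodularBasis F)
    (hF' : IsUnimodularBasis F') : Lp ℂ 2 μ ≃ₗᵢ[ℂ] Lp ℂ 2 ν :=
  (HilbertBasis.mk hF.orthonormal hF.span_eq_top).repr.trans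
    (HilbertBasis.mk hF'.orthonormal hF'.span_eq_top).repr.symm

theorem IsUnimodularBasis.unitary_apply (hF : IsUnimodularBasis F)
    (hF' : IsUnimodularBasis F') (γ : Γ) :
    hF.unitary hF' (unimodularLp 2 (F γ)) = unimodularLp 2 (F' γ) := by
  classical
  have h1 := (HilbertBasis.mk hF.orthonormal hF.span_eq_top).repr_self γ
  have h2 := (HilbertBasis.mk hF'.orthonormal hF'.span_eq_top).repr_symm_single γ
  rw [HilbertBasis.coe_mk] at h1 h2
  rw [unitary, LinearIsometryEquiv.trans_apply, h1, h2]

theorem IsUnimodularBasis.ext {E : Type*} [AddCommGroup E] [Module ℂ E] [TopologicalSpace E]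
    [T2Space E] (hF : IsUnimodularBasis F) {A B : Lp ℂ 2 μ →L[ℂ] E}
    (h : ∀ γ, A (unimodularLp 2 (F γ)) = B (unimodularLp 2 (F γ))) : A = B :=
  ContinuousLinearMap.ext_on (s := Set.range fun γ => unimodularLp 2 (F γ))
    (by rw [dense_iff_closure_eq, ← Submodule.topologicalClosure_coe,
      top_le_iff.1 hF.span_eq_top]; rfl)
    (by rintro _ ⟨γ, rfl⟩; exact h γ)

theorem lpMul_unimodularLp (u v : X →ₘ[μ] Circle) :
    lpMul μ ∞ 2 2 (unimodularLp ∞ u) (unimodularLp 2 v) = unimodularLp 2 (u * v) := by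
  refine Lp.ext ?_
  filter_upwards [coeFn_lpMul (r := 2) (unimodularLp ∞ u) (unimodularLp 2 v),
    coeFn_mul_unimodularLp 2 ∞ 2 u v] with x h1 h2
  rw [h1, h2]

/-- Both sides are continuous and linear in `h`; on the basis, both products follow the group law of
`Γ`. -/
theorem IsUnimodularBasis.unitary_mul_unimodularLp (hF : IsUnimodularBasis F)
    (hF' : IsUnimodularBasis F') (γ : Γ) (h : Lp ℂ 2 μ) :
    hF.unitary hF' (lpMul μ ∞ 2 2 (unimodularLp ∞ (F γ)) h) =
      lpMul ν ∞ 2 2 (unimodularLp ∞ (F' γ)) (hF.unitary hF' h) := by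
  let U : Lp ℂ 2 μ →L[ℂ] Lp ℂ 2 ν := (hF.unitary hF').toContinuousLinearEquiv
  suffices U ∘L lpMul μ ∞ 2 2 (unimodularLp ∞ (F γ)) =
      lpMul ν ∞ 2 2 (unimodularLp ∞ (F' γ)) ∘L U from DFunLike.congr_fun this h
  refine hF.ext fun δ => ?_
  change hF.unitary hF' (lpMul μ ∞ 2 2 _ (unimodularLp 2 (F δ))) =
    lpMul ν ∞ 2 2 _ (hF.unitary hF' (unimodularLp 2 (F δ)))
  rw [lpMul_unimodularLp, ← map_mul, hF.unitary_apply, hF.unitary_apply, lpMul_unimodularLp,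
    map_mul]

/-- Multiplicativity passes from basis vectors to any bounded `g`: for `h` in the basis, the roles
of the factors are exchanged and the previous case applies; then `h` varies by continuity. -/
theorem IsUnimodularBasis.unitary_mul (hF : IsUnimodularBasis F)
    (hF' : IsUnimodularBasis F') (g : Lp ℂ ∞ μ) (g₂ h : Lp ℂ 2 μ) (hg : g =ᵐ[μ] g₂) :
    ∀ᵐ y ∂ν, hF.unitary hF' (lpMul μ ∞ 2 2 g h) y =
      hF.unitary hF' g₂ y * hF.unitary hF' h y := by
  let U : Lp ℂ 2 μ →L[ℂ] Lp ℂ 2 ν := (hF.unitary hF').toContinuousLinearEquiv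
  have hUU : ∀ f, U f = hF.unitary hF' f := fun _ => rfl
  -- The image `U g₂` is not known to be bounded, so the identity is compared in `L¹`;
  -- multiplication by `1` embeds `L²` there.
  have key : lpMul ν 2 2 1 (unimodularLp 2 1) ∘L U ∘L lpMul μ ∞ 2 2 g =
      lpMul ν 2 2 1 (U g₂) ∘L U := by
    refine hF.ext fun γ => Lp.ext ?_
    have h1 : lpMul μ ∞ 2 2 g (unimodularLp 2 (F γ)) =
        lpMul μ ∞ 2 2 (unimodularLp ∞ (F γ)) g₂ := Lp.ext <| by
      filter_upwards [coeFn_lpMul (r := 2) g (unimodularLp 2 (F γ)), hg,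
        coeFn_lpMul (r := 2) (unimodularLp ∞ (F γ)) g₂, coeFn_unimodularLp 2 (F γ),
        coeFn_unimodularLp ∞ (F γ)] with x h1 h2 h3 h4 h5
      rw [h1, h3, h2, h4, h5, mul_comm]
    simp only [ContinuousLinearMap.comp_apply]
    rw [h1, hUU (lpMul μ ∞ 2 2 _ _), hF.unitary_mul_unimodularLp hF', ← hUU]
    filter_upwards [coeFn_lpMul (r := 1) (unimodularLp 2 1)
        (lpMul ν ∞ 2 2 (unimodularLp ∞ (F' γ)) (U g₂)),
      coeFn_lpMul (r := 1) (U g₂) (U (unimodularLp 2 (F γ))),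
      coeFn_lpMul (r := 2) (unimodularLp ∞ (F' γ)) (U g₂),
      coeFn_unimodularLp 2 (1 : Y →ₘ[ν] Circle), AEEqFun.coeFn_one (μ := ν) (β := Circle),
      coeFn_unimodularLp 2 (F' γ), coeFn_unimodularLp ∞ (F' γ)] with y h1 h2 h3 h4 h5 h6 h7
    rw [h1, h2, h3, h4, h5, hUU (unimodularLp 2 (F γ)), hF.unitary_apply hF', h6, h7]
    simp [mul_comm]
  have := DFunLike.congr_fun key h
  simp only [ContinuousLinearMap.comp_apply] at this
  filter_upwards [coeFn_lpMul (r := 1) (unimodularLp 2 1) (U (lpMul μ ∞ 2 2 g h)),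
    coeFn_lpMul (r := 1) (U g₂) (U h), coeFn_unimodularLp 2 (1 : Y →ₘ[ν] Circle),
    AEEqFun.coeFn_one (μ := ν) (β := Circle)] with y h1 h2 h3 h4
  rw [this, h2, h3, h4] at h1
  simpa [hUU] using h1.symm

theorem IsUnimodularBasis.exists_unitary_indicatorLp (hF : IsUnimodularBasis F)
    (hF' : IsUnimodularBasis F') (s : {s : Set X // MeasurableSet s}) :
    ∃ t, hF.unitary hF' (indicatorLp 2 μ s) = indicatorLp 2 ν t := by
  refine exists_indicatorLp_eq_of_mul_self ?_
  have h1 : lpMul μ ∞ 2 2 (indicatorLp ∞ μ s) (indicatorLp 2 μ s) = indicatorLp 2 μ s :=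
    Lp.ext <| by
      filter_upwards [coeFn_lpMul (r := 2) (indicatorLp ∞ μ s) (indicatorLp 2 μ s),
        coeFn_indicatorLp 2 s, coeFn_indicatorLp ∞ s] with x h1 h2 h3
      rw [h1, h3, h2]
      by_cases hx : x ∈ (s : Set X) <;> simp [hx]
  have h2 := hF.unitary_mul hF' (indicatorLp ∞ μ s) (indicatorLp 2 μ s) (indicatorLp 2 μ s)
    ((coeFn_indicatorLp ∞ s).trans (coeFn_indicatorLp 2 s).symm)
  rw [h1] at h2
  exact h2.mono fun _ h => h.symm

/-- Two measure preserving actions whose `L²` spaces have bases formed by the same group of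
eigenfunctions are metrically isomorphic. -/
theorem IsUnimodularBasis.metricallyIsomorphic {G : Type*} [AddGroup G]
    [AddAction G X] [MeasurableConstVAdd G X] [VAddInvariantMeasure G X μ]
    [AddAction G Y] [MeasurableConstVAdd G Y] [VAddInvariantMeasure G Y ν]
    (hF : IsUnimodularBasis F) (hF' : IsUnimodularBasis F') (χ : Γ → G → Circle)
    (hχ : ∀ γ g, koopman μ g (unimodularLp 2 (F γ)) = (χ γ g : ℂ) • unimodularLp 2 (F γ))
    (hχ' : ∀ γ g, koopman ν g (unimodularLp 2 (F' γ)) = (χ γ g : ℂ) • unimodularLp 2 (F' γ)) :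
    MetricallyIsomorphic G μ ν := by
  have hone : hF'.unitary hF (indicatorLp 2 ν ⟨Set.univ, MeasurableSet.univ⟩) =
      indicatorLp 2 μ ⟨Set.univ, MeasurableSet.univ⟩ := by
    rw [← unimodularLp_one, ← unimodularLp_one, ← map_one F', hF'.unitary_apply, map_one]
  obtain ⟨Φ, hΦ⟩ := exists_measureAlgebraIso (hF'.unitary hF) hone
    (hF'.exists_unitary_indicatorLp hF) (hF.exists_unitary_indicatorLp hF')
  refine ⟨Φ, Φ.map_translate (hF'.unitary hF) hΦ fun g f => ?_⟩
  let U : Lp ℂ 2 ν →L[ℂ] Lp ℂ 2 μ := (hF'.unitary hF).toContinuousLinearEquiv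
  suffices U ∘L (koopman ν g).toContinuousLinearMap =
      (koopman μ g).toContinuousLinearMap ∘L U from DFunLike.congr_fun this f
  refine hF'.ext fun γ => ?_
  change hF'.unitary hF (koopman ν g _) = koopman μ g (hF'.unitary hF _)
  rw [hχ', map_smul, hF'.unitary_apply, hχ]

end Unimodular

/-! ### Divisibility of the circle -/

section Extension

/-- A homomorphism of abelian groups with values in the circle extends from a subgroup. -/
theorem Circle.exists_extension {A B : Type*} [CommGroup A] [CommGroup B] (i : A →* B)
    (hi : Function.Injective i) (f : A →* Circle) : ∃ r : B →* Circle, ∀ a, r (i a) = f a := by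
  have hdiv : ∀ {n : ℤ}, n ≠ 0 →
      Function.Surjective fun x : Additive Circle => n • x := fun {n} hn x => by
    obtain ⟨t, ht⟩ := Circle.exp_surjective x.toMul
    refine ⟨Additive.ofMul (Circle.exp (t / n)), ?_⟩
    apply Additive.toMul.injective
    change Circle.exp (t / n) ^ n = x.toMul
    rw [← ht, ← Circle.exp_zsmul]
    congr 1
    have : (n : ℝ) ≠ 0 := by exact_mod_cast hn
    simp [mul_div_cancel₀, this]
  -- By Baer's criterion a divisible abelian group is injective.
  let : DivisibleBy (Additive Circle) ℤ := divisibleByOfSMulRightSurj _ _ hdiv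
  obtain ⟨r, hr⟩ := (Module.Baer.of_divisible (Additive Circle)).extension_property_addMonoidHom
    (MonoidHom.toAdditive i) hi (MonoidHom.toAdditive f)
  exact ⟨MonoidHom.toAdditive.symm r, fun a => DFunLike.congr_fun hr (Additive.ofMul a)⟩

end Extension

/-! ### Ergodicity and unimodular eigenfunctions -/

section Ergodic

variable {G X : Type*} [AddGroup G] [MeasurableSpace X] [AddAction G X] {μ : Measure X}

/-- Preimages of Borel sets are invariant modulo `0`, hence null or conull, and countably many Borel
sets separate the points of `E`. -/
theorem ErgodicVAdd.exists_ae_eq_const [ErgodicVAdd G X μ] {E : Type*} [TopologicalSpace E]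
    [TopologicalSpace.PseudoMetrizableSpace E] [SecondCountableTopology E] [T0Space E] [Nonempty E]
    {f : X → E} (hf : AEStronglyMeasurable f μ)
    (h : ∀ g : G, (fun x => f (g +ᵥ x)) =ᵐ[μ] f) : ∃ c, f =ᵐ[μ] fun _ => c := by
  let : MeasurableSpace E := borel E
  have : BorelSpace E := ⟨rfl⟩
  refine Filter.exists_eventuallyEq_const_of_forall_separating MeasurableSet fun U hU => ?_
  have h1 : Filter.EventuallyConst (f ⁻¹' U) (ae μ) := by
    refine MeasureTheory.aeconst_of_forall_preimage_vadd_ae_eq G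
      (hf.aemeasurable.nullMeasurableSet_preimage hU) fun g => ?_
    filter_upwards [h g] with x hx
    exact congrArg (fun e => e ∈ U) hx
  rcases Filter.eventuallyConst_set.1 h1 with h2 | h2
  · exact Or.inl h2
  · exact Or.inr h2

variable [MeasurableConstVAdd G X] [VAddInvariantMeasure G X μ]

/-- The pairs consisting of a character and a unimodular eigenfunction for this character. -/
noncomputable def eigenfunctionGroup (G : Type*) [AddGroup G] [TopologicalSpace G]
    [AddAction G X] [MeasurableConstVAdd G X] (μ : Measure X) [VAddInvariantMeasure G X μ] :
    Subgroup (PontryaginDual (Multiplicative G) × (X →ₘ[μ] Circle)) where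
  carrier := {p | ∀ g : G, ∀ᵐ x ∂μ, p.2 (g +ᵥ x) = p.1 (Multiplicative.ofAdd g) * p.2 x}
  mul_mem' := by
    intro p q hp hq g
    have h := AEEqFun.coeFn_mul p.2 q.2
    filter_upwards [hp g, hq g, h,
      (measurePreserving_vadd g μ).quasiMeasurePreserving.ae h] with x h1 h2 h3 h4
    rw [Prod.snd_mul, h4, Pi.mul_apply, h1, h2, h3, Pi.mul_apply]
    exact mul_mul_mul_comm _ _ _ _
  one_mem' := by
    intro g
    have h := AEEqFun.coeFn_one (μ := μ) (β := Circle)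
    filter_upwards [h, (measurePreserving_vadd g μ).quasiMeasurePreserving.ae h] with x h1 h2
    rw [Prod.snd_one, h1, h2]
    simp
  inv_mem' := by
    intro p hp g
    have h := AEEqFun.coeFn_inv p.2
    filter_upwards [hp g, h,
      (measurePreserving_vadd g μ).quasiMeasurePreserving.ae h] with x h1 h3 h4
    rw [Prod.snd_inv, h4, Pi.inv_apply, h1, h3, Pi.inv_apply, mul_inv]
    rfl

variable [TopologicalSpace G]

theorem koopman_unimodularLp [IsFiniteMeasure μ]
    {p : PontryaginDual (Multiplicative G) × (X →ₘ[μ] Circle)}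
    (hp : p ∈ eigenfunctionGroup G μ) (g : G) :
    koopman μ g (unimodularLp 2 p.2) =
      (p.1 (Multiplicative.ofAdd g) : ℂ) • unimodularLp 2 p.2 := by
  refine Lp.ext ?_
  have h := coeFn_unimodularLp 2 p.2
  filter_upwards [hp g, h, (measurePreserving_vadd g μ).quasiMeasurePreserving.ae h,
    Lp.coeFn_compMeasurePreserving (unimodularLp 2 p.2) (measurePreserving_vadd g μ),
    Lp.coeFn_smul (p.1 (Multiplicative.ofAdd g) : ℂ) (unimodularLp 2 p.2)] with x h1 h2 h3 h4 h5
  rw [h5, Pi.smul_apply, h2]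
  refine h4.trans ?_
  rw [Function.comp_apply, h3, h1, Circle.coe_mul, smul_eq_mul]

theorem const_mem_eigenfunctionGroup (c : Circle) :
    (1, AEEqFun.const X c) ∈ eigenfunctionGroup G μ := by
  intro g
  have h := AEEqFun.coeFn_const X c (μ := μ)
  filter_upwards [h, (measurePreserving_vadd g μ).quasiMeasurePreserving.ae h] with x h1 h2
  rw [h1, h2]
  simp

end Ergodic

/-! ### A multiplicative choice of eigenfunctions -/

section Ergodic

variable {G X : Type*} [AddGroup G] [TopologicalSpace G] [MeasurableSpace X] [AddAction G X]
  [MeasurableConstVAdd G X] {μ : Measure X} [ErgodicVAdd G X μ]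

theorem exists_eq_const_of_mem_eigenfunctionGroup {f : X →ₘ[μ] Circle}
    (hf : (1, f) ∈ eigenfunctionGroup G μ) : ∃ c : Circle, f = AEEqFun.const X c := by
  obtain ⟨c, hc⟩ := ErgodicVAdd.exists_ae_eq_const (G := G) f.aestronglyMeasurable
    fun g => (hf g).mono fun x hx => by simpa using hx
  exact ⟨c, AEEqFun.ext (hc.trans (AEEqFun.coeFn_const X c).symm)⟩

/-- By divisibility of the circle, unimodular eigenfunctions can be chosen multiplicatively in
their eigenvalues. -/
theorem exists_section_eigenfunctionGroup [NeZero μ] :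
    ∃ F : (eigenfunctionGroup G μ).map (MonoidHom.fst _ _) →* (X →ₘ[μ] Circle),
      ∀ χ : (eigenfunctionGroup G μ).map (MonoidHom.fst _ _),
        ((χ : PontryaginDual (Multiplicative G)), F χ) ∈ eigenfunctionGroup G μ := by
  let H := eigenfunctionGroup G μ
  let i : Circle →* H :=
    { toFun := fun c => ⟨(1, AEEqFun.const X c), const_mem_eigenfunctionGroup c⟩
      map_one' := rfl
      map_mul' := fun c c' => Subtype.ext <| Prod.ext (mul_one _).symm <| rfl }
  have hi : Function.Injective i := fun c c' h => by
    have h2 : AEEqFun.const X c = (AEEqFun.const X c' : X →ₘ[μ] Circle) :=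
      congrArg (fun p : H => p.1.2) h
    obtain ⟨x⟩ : Nonempty X := μ.nonempty_of_neZero
    rw [← AEEqFun.coeFn_const_eq (μ := μ) X c x, h2, AEEqFun.coeFn_const_eq]
  -- A retraction `r` onto the constants; its kernel is a complement, which should contain one
  -- eigenfunction for each eigenvalue.
  obtain ⟨r, hr⟩ := Circle.exists_extension i hi (MonoidHom.id _)
  let q : r.ker →* H.map (MonoidHom.fst _ _) :=
    { toFun := fun h => ⟨h.1.1.1, h.1.1, h.1.2, rfl⟩
      map_one' := rfl
      map_mul' := fun _ _ => rfl }
  have hq : Function.Bijective q := by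
    constructor
    · rw [injective_iff_map_eq_one]
      rintro ⟨⟨⟨χ, f⟩, hH⟩, hker⟩ h
      have h1 : χ = 1 := congrArg Subtype.val h
      subst h1
      obtain ⟨c, rfl⟩ := exists_eq_const_of_mem_eigenfunctionGroup hH
      have h2 : c = 1 := (hr c).symm.trans hker
      subst h2
      rfl
    · rintro ⟨χ, p, hp, rfl⟩
      -- Dividing by the constant `r p` moves `p` into the kernel without changing its character.
      refine ⟨⟨⟨p, hp⟩ * (i (r ⟨p, hp⟩))⁻¹, ?_⟩, ?_⟩
      · rw [MonoidHom.mem_ker, map_mul, map_inv, hr, MonoidHom.id_apply, mul_inv_cancel]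
      · refine Subtype.ext ?_
        change p.1 * (1 : PontryaginDual (Multiplicative G))⁻¹ = p.1
        simp
  let e := MulEquiv.ofBijective q hq
  refine ⟨(MonoidHom.snd _ _).comp (H.subtype.comp (r.ker.subtype.comp e.symm.toMonoidHom)),
    fun χ => ?_⟩
  have h1 : ((e.symm χ).1.1.1 : PontryaginDual (Multiplicative G)) = χ :=
    congrArg Subtype.val (e.apply_symm_apply χ)
  have h2 := (e.symm χ).1.2
  rw [show (e.symm χ).1.1 = ((χ : PontryaginDual (Multiplicative G)), (e.symm χ).1.1.2) from
    Prod.ext h1 rfl] at h2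
  exact h2

/-- Up to a constant, eigenfunctions of ergodic actions are unimodular. -/
theorem IsEigenfunction.exists_unimodular [IsFiniteMeasure μ]
    {f : Lp ℂ 2 μ} (hf : IsEigenfunction G μ f) :
    ∃ p ∈ eigenfunctionGroup G μ, ∃ c : ℂ, f = c • unimodularLp 2 p.2 := by
  obtain ⟨h0, χ, hχ⟩ := hf
  have hχ' : ∀ g : G, ∀ᵐ x ∂μ, f (g +ᵥ x) = (χ (Multiplicative.ofAdd g) : ℂ) * f x := fun g => by
    have h1 := Lp.coeFn_smul (χ (Multiplicative.ofAdd g) : ℂ) f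
    rw [← hχ] at h1
    filter_upwards [h1, Lp.coeFn_compMeasurePreserving f (measurePreserving_vadd g μ)] with x h1 h2
    exact h2.symm.trans h1
  obtain ⟨c, hc⟩ := ErgodicVAdd.exists_ae_eq_const (G := G) (Lp.aestronglyMeasurable f).norm
    fun g => (hχ' g).mono fun x hx => by
      change ‖f (g +ᵥ x)‖ = ‖f x‖
      rw [hx, norm_mul, Circle.norm_coe, one_mul]
  have hc0 : c ≠ 0 := by
    rintro rfl
    exact h0 ((Lp.eq_zero_iff_ae_eq_zero).2 (hc.mono fun x hx => norm_eq_zero.1 hx))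
  have hmeas : AEStronglyMeasurable (fun x => Circle.exp (Complex.arg (f x))) μ :=
    Circle.exp.continuous.comp_aestronglyMeasurable
      (Complex.measurable_arg.comp_aemeasurable
        (Lp.aestronglyMeasurable f).aemeasurable).aestronglyMeasurable
  have hu := AEEqFun.coeFn_mk _ hmeas
  have hfu : ∀ᵐ x ∂μ, f x = c * (AEEqFun.mk _ hmeas x : ℂ) := by
    filter_upwards [hc, hu] with x h1 h2
    rw [h2, ← h1, Circle.coe_exp, Complex.norm_mul_exp_arg_mul_I]
  refine ⟨(χ, AEEqFun.mk _ hmeas), fun g => ?_, c, Lp.ext ?_⟩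
  · filter_upwards [hfu, (measurePreserving_vadd g μ).quasiMeasurePreserving.ae hfu, hχ' g]
      with x h1 h2 h3
    refine Circle.coe_injective (mul_left_cancel₀ (Complex.ofReal_ne_zero.2 hc0) ?_)
    rw [← h2, h3, h1, Circle.coe_mul]
    ring
  · filter_upwards [hfu, coeFn_unimodularLp 2 (AEEqFun.mk _ hmeas),
      Lp.coeFn_smul (c : ℂ) (unimodularLp 2 (AEEqFun.mk _ hmeas))] with x h1 h2 h3
    rw [h3, h1, Pi.smul_apply, h2, smul_eq_mul]

theorem HasPurePointSpectrum.exists_isUnimodularBasis [IsProbabilityMeasure μ]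
    (h : HasPurePointSpectrum G μ) :
    ∃ (Γ : Subgroup (PontryaginDual (Multiplicative G))) (F : Γ →* (X →ₘ[μ] Circle)),
      IsUnimodularBasis F ∧ ∀ (γ : Γ) (g : G), koopman μ g (unimodularLp 2 (F γ)) =
        (γ.1 (Multiplicative.ofAdd g) : ℂ) • unimodularLp 2 (F γ) := by
  obtain ⟨F, hF⟩ := exists_section_eigenfunctionGroup (G := G) (μ := μ)
  have hk := fun γ (g : G) => koopman_unimodularLp (hF γ) g
  refine ⟨_, F, ⟨?_, ?_⟩, hk⟩
  · refine orthonormal_unimodularLp_of_koopman F (fun γ g => γ.1 (Multiplicative.ofAdd g)) ?_ hk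
    exact fun γ δ h => Subtype.ext (PontryaginDual.ext fun a => congrFun h a.toAdd)
  · obtain ⟨S, b, hb, hS⟩ := h
    rw [← b.dense_span]
    refine Submodule.topologicalClosure_mono (Submodule.span_le.2 ?_)
    rintro _ ⟨f, rfl⟩
    rw [hb]
    obtain ⟨p, hp, c, hc⟩ := (hS f f.2).exists_unimodular
    let γ : (eigenfunctionGroup G μ).map (MonoidHom.fst _ _) := ⟨p.1, p, hp, rfl⟩
    -- Eigenvalues are simple: the quotient of two unimodular eigenfunctions for the same character
    -- is invariant, hence constant.
    have h1 : (1, p.2 * (F γ)⁻¹) ∈ eigenfunctionGroup G μ := by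
      have := mul_mem hp (inv_mem (hF γ))
      simpa [γ, Prod.mul_def] using this
    obtain ⟨z, hz⟩ := exists_eq_const_of_mem_eigenfunctionGroup h1
    have h2 : unimodularLp 2 p.2 = (z : ℂ) • unimodularLp 2 (F γ) := by
      rw [mul_inv_eq_iff_eq_mul.1 hz]
      refine Lp.ext ?_
      filter_upwards [coeFn_unimodularLp 2 (AEEqFun.const X z * F γ), coeFn_unimodularLp 2 (F γ),
        AEEqFun.coeFn_mul (AEEqFun.const X z) (F γ), AEEqFun.coeFn_const X z (μ := μ),
        Lp.coeFn_smul (z : ℂ) (unimodularLp 2 (F γ))] with x h1 h2 h3 h4 h5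
      rw [h5, h1, h3, Pi.mul_apply, h4, Pi.smul_apply, h2]
      simp
    change (f : Lp ℂ 2 μ) ∈ Submodule.span ℂ _
    rw [hc, h2]
    exact Submodule.smul_mem _ _ (Submodule.smul_mem _ _ (Submodule.subset_span ⟨γ, rfl⟩))

end Ergodic

/-! ### The compact group dual to the eigenvalues -/

section RotationGroup

variable {G : Type*} [AddGroup G] [TopologicalSpace G]
  (Γ : Subgroup (PontryaginDual (Multiplicative G)))

/-- Evaluation of all the characters in `Γ`, as a homomorphism into a torus. -/
noncomputable def characterEval : Multiplicative G →* (Γ → Circle) where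
  toFun g γ := γ.1 g
  map_one' := funext fun γ => map_one γ.1
  map_mul' g h := funext fun γ => map_mul γ.1 g h

/-- The closure of the image of `G` in the torus of the characters in `Γ`. This is the dual group
of the discrete group `Γ`. -/
def RotationGroup : Type _ := (characterEval Γ).range.topologicalClosure

namespace RotationGroup

noncomputable instance : CommGroup (RotationGroup Γ) :=
  inferInstanceAs (CommGroup (characterEval Γ).range.topologicalClosure)

instance : TopologicalSpace (RotationGroup Γ) :=
  inferInstanceAs (TopologicalSpace (characterEval Γ).range.topologicalClosure)

instance : IsTopologicalGroup (RotationGroup Γ) :=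
  inferInstanceAs (IsTopologicalGroup (characterEval Γ).range.topologicalClosure)

instance : T2Space (RotationGroup Γ) :=
  inferInstanceAs (T2Space (characterEval Γ).range.topologicalClosure)

instance : CompactSpace (RotationGroup Γ) :=
  isCompact_iff_compactSpace.1 (Subgroup.isClosed_topologicalClosure _).isCompact

instance : MeasurableSpace (RotationGroup Γ) := borel _

instance : BorelSpace (RotationGroup Γ) := ⟨rfl⟩

/-- The canonical homomorphism with dense range. -/
noncomputable def ofMul : Multiplicative G →* RotationGroup Γ where
  toFun g := ⟨characterEval Γ g, subset_closure ⟨g, rfl⟩⟩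
  map_one' := Subtype.ext (map_one _)
  map_mul' g h := Subtype.ext (map_mul _ g h)

variable {Γ}

/-- The coordinates, which are the characters of the rotation group. -/
noncomputable def coord (γ : Γ) : RotationGroup Γ →* Circle where
  toFun ξ := ξ.1 γ
  map_one' := rfl
  map_mul' _ _ := rfl

theorem continuous_coord (γ : Γ) : Continuous (coord γ) :=
  (continuous_apply γ).comp continuous_subtype_val

theorem ext {ξ η : RotationGroup Γ} (h : ∀ γ, coord γ ξ = coord γ η) : ξ = η :=
  Subtype.ext (funext h)

theorem continuous_ofMul : Continuous fun g : G => ofMul Γ (Multiplicative.ofAdd g) :=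
  Continuous.subtype_mk (continuous_pi fun γ : Γ =>
    show Continuous fun g : G => γ.1 (Multiplicative.ofAdd g) from
      (map_continuous γ.1).comp continuous_ofAdd) _

variable (Γ) in
theorem isEmbedding_coord :
    Topology.IsEmbedding fun (ξ : RotationGroup Γ) (γ : Γ) => coord γ ξ :=
  Topology.IsEmbedding.subtypeVal

theorem denseRange_ofMul : DenseRange (ofMul Γ) := by
  intro ξ
  rw [(isEmbedding_coord Γ).isInducing.closure_eq_preimage_closure_image, ← Set.range_comp]
  exact ξ.2

theorem coord_one (ξ : RotationGroup Γ) : coord (1 : Γ) ξ = 1 :=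
  denseRange_ofMul.induction_on ξ
    (isClosed_eq (continuous_coord _) continuous_const) fun _ => rfl

theorem coord_mul (γ δ : Γ) (ξ : RotationGroup Γ) : coord (γ * δ) ξ = coord γ ξ * coord δ ξ :=
  denseRange_ofMul.induction_on ξ
    (isClosed_eq (continuous_coord _) ((continuous_coord _).mul (continuous_coord _)))
    fun _ => rfl

theorem coord_inv (γ : Γ) (ξ : RotationGroup Γ) : coord γ⁻¹ ξ = (coord γ ξ)⁻¹ :=
  eq_inv_of_mul_eq_one_left (by rw [← coord_mul, inv_mul_cancel, coord_one])

noncomputable instance : AddAction G (RotationGroup Γ) where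
  vadd g ξ := ofMul Γ (Multiplicative.ofAdd g) * ξ
  zero_vadd ξ := by
    change ofMul Γ (Multiplicative.ofAdd 0) * ξ = ξ
    rw [ofAdd_zero, map_one, one_mul]
  add_vadd g h ξ := by
    change ofMul Γ (Multiplicative.ofAdd (g + h)) * ξ = ofMul Γ _ * (ofMul Γ _ * ξ)
    rw [ofAdd_add, map_mul, mul_assoc]

theorem vadd_def (g : G) (ξ : RotationGroup Γ) :
    g +ᵥ ξ = ofMul Γ (Multiplicative.ofAdd g) * ξ := rfl

instance : ContinuousVAdd G (RotationGroup Γ) :=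
  ⟨(continuous_ofMul.comp continuous_fst).mul continuous_snd⟩

theorem isRotation : IsRotation G (RotationGroup Γ) := ⟨ofMul Γ, fun _ _ => rfl⟩

instance : (normalisedHaar (RotationGroup Γ)).IsHaarMeasure :=
  inferInstanceAs (Measure.haarMeasure _).IsHaarMeasure

instance : (normalisedHaar (RotationGroup Γ)).Regular :=
  inferInstanceAs (Measure.haarMeasure _).Regular

instance : IsProbabilityMeasure (normalisedHaar (RotationGroup Γ)) :=
  ⟨Measure.haarMeasure_self (K₀ := ⊤)⟩

instance : VAddInvariantMeasure G (RotationGroup Γ) (normalisedHaar (RotationGroup Γ)) :=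
  ⟨fun g s _ => measure_preimage_mul _ (ofMul Γ (Multiplicative.ofAdd g)) s⟩

/-- The coordinates as complex valued continuous functions. -/
noncomputable def monomial (γ : Γ) : C(RotationGroup Γ, ℂ) :=
  ⟨fun ξ => coord γ ξ, continuous_circle_coe.comp (continuous_coord γ)⟩

/-- Stone–Weierstrass: since `Γ` is a group, the monomials are closed under products and
conjugation, so their span is a star subalgebra. They separate points because a point is determined
by its coordinates. -/
theorem span_monomial_closure_eq_top :
    (Submodule.span ℂ (Set.range (monomial (Γ := Γ)))).topologicalClosure = ⊤ := by
  let A : StarSubalgebra ℂ C(RotationGroup Γ, ℂ) :=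
    { toSubalgebra := Algebra.adjoin ℂ (Set.range monomial)
      star_mem' := by
        change Algebra.adjoin ℂ (Set.range (monomial (Γ := Γ))) ≤
          star (Algebra.adjoin ℂ (Set.range (monomial (Γ := Γ))))
        refine Algebra.adjoin_le ?_
        rintro - ⟨γ, rfl⟩
        refine Algebra.subset_adjoin ⟨γ⁻¹, ContinuousMap.ext fun ξ => ?_⟩
        change (coord γ⁻¹ ξ : ℂ) = (starRingEnd ℂ) (coord γ ξ : ℂ)
        rw [coord_inv, Circle.coe_inv_eq_conj] }
  have hA : Subalgebra.toSubmodule A.toSubalgebra = Submodule.span ℂ (Set.range monomial) := by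
    refine Algebra.adjoin_eq_span_of_subset ℂ (Set.Subset.trans ?_ Submodule.subset_span)
    intro x hx
    refine Submonoid.closure_induction (fun _ => id) ⟨1, ?_⟩ ?_ hx
    · exact ContinuousMap.ext fun ξ => congrArg Subtype.val (coord_one ξ)
    · rintro - - - - ⟨γ, rfl⟩ ⟨δ, rfl⟩
      exact ⟨γ * δ, ContinuousMap.ext fun ξ => congrArg Subtype.val (coord_mul γ δ ξ)⟩
  have hsep : A.SeparatesPoints := by
    intro ξ η hne
    by_contra! h
    refine hne (ext fun γ => Circle.coe_injective ?_)
    exact h _ ⟨monomial γ, Algebra.subset_adjoin ⟨γ, rfl⟩, rfl⟩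
  rw [← hA]
  exact congr_arg (Subalgebra.toSubmodule <| StarSubalgebra.toSubalgebra ·)
    (ContinuousMap.starSubalgebra_topologicalClosure_eq_top_of_separatesPoints A hsep)

/-- The coordinates as classes of measurable functions. -/
noncomputable def coordAEEqFun : Γ →* (RotationGroup Γ →ₘ[normalisedHaar (RotationGroup Γ)] Circle)
    where
  toFun γ := AEEqFun.mk _ (continuous_coord γ).aestronglyMeasurable
  map_one' := AEEqFun.mk_eq_mk.2 (.of_forall coord_one)
  map_mul' γ δ := AEEqFun.mk_eq_mk.2 (.of_forall (coord_mul γ δ))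

theorem coeFn_unimodularLp_coordAEEqFun (γ : Γ) :
    unimodularLp 2 (coordAEEqFun γ) =ᵐ[normalisedHaar (RotationGroup Γ)] monomial γ := by
  filter_upwards [coeFn_unimodularLp 2 (coordAEEqFun γ), AEEqFun.coeFn_mk _
    (continuous_coord γ).aestronglyMeasurable (μ := normalisedHaar (RotationGroup Γ))] with ξ h1 h2
  rw [h1]
  exact congrArg Subtype.val h2

theorem koopman_coordAEEqFun (γ : Γ) (g : G) :
    koopman (normalisedHaar (RotationGroup Γ)) g (unimodularLp 2 (coordAEEqFun γ)) =
      (γ.1 (Multiplicative.ofAdd g) : ℂ) • unimodularLp 2 (coordAEEqFun γ) := by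
  refine Lp.ext ?_
  have hmp := measurePreserving_vadd g (normalisedHaar (RotationGroup Γ))
  have h := coeFn_unimodularLp_coordAEEqFun γ
  filter_upwards [h, hmp.quasiMeasurePreserving.ae h,
    Lp.coeFn_compMeasurePreserving (unimodularLp 2 (coordAEEqFun γ)) hmp,
    Lp.coeFn_smul (γ.1 (Multiplicative.ofAdd g) : ℂ) (unimodularLp 2 (coordAEEqFun γ))]
    with ξ h1 h2 h3 h4
  rw [h4, Pi.smul_apply, h1]
  refine h3.trans ?_
  rw [Function.comp_apply, h2]
  change (coord γ (ofMul Γ (Multiplicative.ofAdd g) * ξ) : ℂ) = _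
  rw [map_mul, Circle.coe_mul]
  rfl

theorem isUnimodularBasis : IsUnimodularBasis (coordAEEqFun (Γ := Γ)) where
  orthonormal := orthonormal_unimodularLp_of_koopman _
    (fun γ g => γ.1 (Multiplicative.ofAdd g))
    (fun _ _ h => Subtype.ext (PontryaginDual.ext fun a => congrFun h a.toAdd))
    koopman_coordAEEqFun
  span_eq_top := by
    have h := (ContinuousMap.toLp_denseRange (p := 2) ℂ (normalisedHaar (RotationGroup Γ)) ℂ
      (by simp)).topologicalClosure_map_submodule span_monomial_closure_eq_top
    rw [Submodule.map_span, ← Set.range_comp] at h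
    rw [← h]
    refine Submodule.topologicalClosure_mono (Submodule.span_mono ?_)
    rintro _ ⟨γ, rfl⟩
    refine ⟨γ, Lp.ext ((coeFn_unimodularLp_coordAEEqFun γ).trans ?_)⟩
    exact (ContinuousMap.coeFn_toLp (normalisedHaar (RotationGroup Γ)) (monomial γ)).symm

/-! ### Unique ergodicity -/

section UniquelyErgodic

variable (ν : Measure (RotationGroup Γ)) [VAddInvariantMeasure G (RotationGroup Γ) ν]

/-- Translation by `g` multiplies the integral by `γ g`, while invariance leaves it unchanged; some
`γ g` is not `1`. -/
theorem integral_monomial_of_ne_one {γ : Γ} (hγ : γ ≠ 1) : ∫ ξ, monomial γ ξ ∂ν = 0 := by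
  obtain ⟨g, hg⟩ : ∃ g : G, γ.1 (Multiplicative.ofAdd g) ≠ 1 := by
    by_contra! h
    exact hγ (Subtype.ext (PontryaginDual.ext fun a => h a.toAdd))
  have h := (measurePreserving_vadd g ν).integral_comp
    (MeasurableEquiv.vadd g).measurableEmbedding (monomial γ)
  have h2 : ∀ ξ, monomial γ (g +ᵥ ξ) = (γ.1 (Multiplicative.ofAdd g) : ℂ) * monomial γ ξ :=
    fun ξ => by
      change (coord γ (ofMul Γ (Multiplicative.ofAdd g) * ξ) : ℂ) = _
      rw [map_mul, Circle.coe_mul]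
      rfl
  simp_rw [h2, integral_const_mul] at h
  by_contra h0
  exact hg (Circle.coe_eq_one.1 (mul_right_cancel₀ h0 (by rw [h, one_mul])))

variable [IsProbabilityMeasure ν]

theorem integral_eq_of_vaddInvariant (f : C(RotationGroup Γ, ℂ)) :
    ∫ ξ, f ξ ∂ν = ∫ ξ, f ξ ∂(normalisedHaar (RotationGroup Γ)) := by
  have hint : ∀ ρ : Measure (RotationGroup Γ), IsProbabilityMeasure ρ →
      ∀ f : C(RotationGroup Γ, ℂ), Integrable f ρ := fun ρ _ f =>
    f.continuous.integrable_of_hasCompactSupport (HasCompactSupport.of_compactSpace _)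
  have hcont : ∀ ρ : Measure (RotationGroup Γ), IsProbabilityMeasure ρ →
      Continuous fun f : C(RotationGroup Γ, ℂ) => ∫ ξ, f ξ ∂ρ := fun ρ _ =>
    (LipschitzWith.of_dist_le_mul (K := 1) fun f g => by
      rw [dist_eq_norm, ← integral_sub (hint ρ inferInstance f) (hint ρ inferInstance g),
        NNReal.coe_one, one_mul, dist_eq_norm]
      refine (norm_integral_le_of_norm_le_const (C := ‖f - g‖)
        (.of_forall fun ξ => (f - g).norm_coe_le_norm ξ)).trans ?_
      simp).continuous
  have hf : f ∈ closure (Submodule.span ℂ (Set.range (monomial (Γ := Γ))) : Set _) := by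
    rw [← Submodule.topologicalClosure_coe, span_monomial_closure_eq_top]
    trivial
  refine closure_minimal ?_ (isClosed_eq (hcont ν inferInstance)
    (hcont (normalisedHaar (RotationGroup Γ)) inferInstance)) hf
  intro f hf
  induction hf using Submodule.span_induction with
  | mem f hf =>
    obtain ⟨γ, rfl⟩ := hf
    by_cases hγ : γ = 1
    · subst hγ
      have : ∀ ξ, monomial (1 : Γ) ξ = 1 := fun ξ => congrArg Subtype.val (coord_one ξ)
      simp [this]
    · exact (integral_monomial_of_ne_one ν hγ).trans (integral_monomial_of_ne_one _ hγ).symm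
  | zero => simp
  | add f g _ _ hf hg =>
    simp only [Set.mem_ofPred_eq, ContinuousMap.add_apply] at hf hg ⊢
    rw [integral_add (hint ν inferInstance f) (hint ν inferInstance g),
      integral_add (hint _ inferInstance f) (hint _ inferInstance g), hf, hg]
  | smul c f _ hf =>
    simp only [Set.mem_ofPred_eq, ContinuousMap.smul_apply] at hf ⊢
    rw [integral_smul, integral_smul, hf]

/-- On the real line, integrals of continuous functions determine a finite measure, so no regularity
of `ν` is needed. -/
theorem map_eq_of_vaddInvariant {f : RotationGroup Γ → ℝ} (hf : Continuous f) :
    ν.map f = (normalisedHaar (RotationGroup Γ)).map f := by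
  have := Measure.isProbabilityMeasure_map (μ := ν) hf.aemeasurable
  have := Measure.isProbabilityMeasure_map (μ := normalisedHaar (RotationGroup Γ)) hf.aemeasurable
  refine ext_of_forall_integral_eq_of_IsFiniteMeasure fun h => ?_
  rw [integral_map hf.aemeasurable h.continuous.aestronglyMeasurable,
    integral_map hf.aemeasurable h.continuous.aestronglyMeasurable]
  have key := integral_eq_of_vaddInvariant ν ⟨fun ξ => ((h (f ξ) : ℝ) : ℂ), by fun_prop⟩
  simp only [ContinuousMap.coe_mk, integral_complex_ofReal] at key
  exact_mod_cast key

/-- Any invariant Borel probability measure on the rotation group, regular or not, is the Haar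
measure. -/
theorem eq_normalisedHaar_of_vaddInvariant : ν = normalisedHaar (RotationGroup Γ) := by
  have hle : ∀ s, MeasurableSet s → normalisedHaar (RotationGroup Γ) s ≤ ν s := fun s hs => by
    refine le_of_forall_lt fun r hr => ?_
    -- Haar measure is inner regular for level sets `f ⁻¹' {1}` of continuous functions, and on
    -- these both measures agree.
    obtain ⟨k, hks, ⟨f, hf, -, rfl⟩, hk⟩ :=
      Measure.innerRegularWRT_preimage_one_hasCompactSupport_measure_ne_top_of_group
        (μ := normalisedHaar (RotationGroup Γ)) ⟨hs, measure_ne_top _ _⟩ r hr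
    refine hk.trans_le (le_trans (le_of_eq ?_) (measure_mono hks))
    rw [← Measure.map_apply hf.measurable (measurableSet_singleton 1),
      ← map_eq_of_vaddInvariant ν hf,
      Measure.map_apply hf.measurable (measurableSet_singleton 1)]
  refine Measure.ext fun s hs => le_antisymm ?_ (hle s hs)
  -- Both measures have total mass `1`, so the inequality for the complement reverses the one for
  -- `s`.
  have h := hle sᶜ hs.compl
  rw [prob_compl_eq_one_sub hs, prob_compl_eq_one_sub hs] at h
  exact (ENNReal.sub_le_sub_iff_left prob_le_one ENNReal.one_ne_top).1 h

end UniquelyErgodic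

theorem uniquelyErgodic : UniquelyErgodic G (RotationGroup Γ) := by
  refine ⟨normalisedHaar (RotationGroup Γ), ⟨inferInstance, inferInstance⟩, ?_⟩
  rintro ν ⟨h1, h2⟩
  exact eq_normalisedHaar_of_vaddInvariant ν

/-! ### The invariant metric and the main theorem -/

/-- Translation rotates each coordinate by a unit complex number, so every term of the product
metric is invariant. -/
theorem metrisableByInvariantMetric [Countable Γ] :
    MetrisableByInvariantMetric G (RotationGroup Γ) := by
  let := Encodable.ofCountable Γ
  let d : MetricSpace (Γ → Circle) := PiCountable.metricSpace
  refine ⟨MetricSpace.induced _ (isEmbedding_coord Γ).injective d,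
    (isEmbedding_coord Γ).eq_induced.symm, fun g ξ η => ?_⟩
  change ∑' γ, min (2⁻¹ ^ Encodable.encode γ) (dist (coord γ (g +ᵥ ξ)) (coord γ (g +ᵥ η))) =
    ∑' γ, min (2⁻¹ ^ Encodable.encode γ) (dist (coord γ ξ) (coord γ η))
  refine tsum_congr fun γ => ?_
  have h : ∀ a x y : Circle, dist (a * x) (a * y) = dist x y := fun a x y => by
    change dist (a * x : ℂ) (a * y) = dist (x : ℂ) y
    rw [dist_eq_norm, ← mul_sub, norm_mul, Circle.norm_coe, one_mul, dist_eq_norm]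
  rw [vadd_def, vadd_def, map_mul, map_mul, h]

end RotationGroup

end RotationGroup

/-- Orthonormal vectors lie at distance `√2`, so the balls of radius `1 / 2` about them are
disjoint, and a separable space has only countably many disjoint nonempty open sets. -/
theorem HilbertBasis.countable_of_orthonormal {E ι κ : Type*} [NormedAddCommGroup E]
    [InnerProductSpace ℂ E] [Countable ι] (b : HilbertBasis ι ℂ E) {v : κ → E}
    (hv : Orthonormal ℂ v) : Countable κ := by
  have hsep : TopologicalSpace.SeparableSpace E := by
    rw [← TopologicalSpace.isSeparable_univ_iff]
    have h1 := ((Set.countable_range b).isSeparable.span (R := ℂ)).closure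
    have h2 := congrArg (fun S : Submodule ℂ E => (S : Set E)) b.dense_span
    rw [Submodule.topologicalClosure_coe] at h2
    rw [h2] at h1
    exact h1
  have hdisj : Pairwise (Function.onFun Disjoint fun i => Metric.ball (v i) (1 / 2)) := by
    intro i j hij
    refine Metric.ball_disjoint_ball ?_
    have h1 : ‖v i - v j‖ ^ 2 = 2 := by
      rw [@norm_sub_sq ℂ, hv.1, hv.1, hv.2 hij]
      norm_num
    rw [dist_eq_norm]
    nlinarith [norm_nonneg (v i - v j)]
  exact hdisj.countable_of_isOpen_disjoint (fun _ => Metric.isOpen_ball)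
    fun i => ⟨v i, Metric.mem_ball_self (by norm_num)⟩

theorem mainTheorem6 (d : ℕ) {Ω : Type*} [MeasurableSpace Ω]
    [AddAction (EuclideanSpace ℝ (Fin d)) Ω]
    [MeasurableConstVAdd (EuclideanSpace ℝ (Fin d)) Ω]
    (m : Measure Ω) [IsProbabilityMeasure m]
    [ErgodicVAdd (EuclideanSpace ℝ (Fin d)) Ω m]
    (hpp : HasPurePointSpectrum (EuclideanSpace ℝ (Fin d)) m) :
    ∃ (K : Type) (_ : CommGroup K) (_ : TopologicalSpace K) (_ : IsTopologicalGroup K)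
      (_ : CompactSpace K) (_ : T2Space K) (_ : MeasurableSpace K) (_ : BorelSpace K)
      (_ : AddAction (EuclideanSpace ℝ (Fin d)) K)
      (_ : ContinuousVAdd (EuclideanSpace ℝ (Fin d)) K)
      (_ : VAddInvariantMeasure (EuclideanSpace ℝ (Fin d)) K (normalisedHaar K)),
      IsRotation (EuclideanSpace ℝ (Fin d)) K ∧
      UniquelyErgodic (EuclideanSpace ℝ (Fin d)) K ∧
      MetricallyIsomorphic (EuclideanSpace ℝ (Fin d)) m (normalisedHaar K) ∧
      (HasCountableOrthonormalBasis m →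
        MetrisableByInvariantMetric (EuclideanSpace ℝ (Fin d)) K) := by
  obtain ⟨Γ, F, hF, hk⟩ := hpp.exists_isUnimodularBasis
  refine ⟨RotationGroup Γ, inferInstance, inferInstance, inferInstance, inferInstance,
    inferInstance, inferInstance, inferInstance, inferInstance, inferInstance, inferInstance,
    RotationGroup.isRotation, RotationGroup.uniquelyErgodic,
    hF.metricallyIsomorphic RotationGroup.isUnimodularBasis
      (fun γ g => γ.1 (Multiplicative.ofAdd g)) hk RotationGroup.koopman_coordAEEqFun, ?_⟩
  rintro ⟨S, b, -, hS⟩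
  have := hS.to_subtype
  -- The chosen eigenfunctions are an orthonormal family indexed by `Γ`, so `Γ` is countable.
  have := b.countable_of_orthonormal hF.orthonormal
  exact RotationGroup.metrisableByInvariantMetric
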